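/- **Setting.** Let $K$ and $L$ be groups with isomorphic subgroups identified with one group $H$ (so $K\cap L=H$), and let $L^*=K*_H L$ be their free product with amalgamation over $H$; $K$ and $L$ are regarded as subgroups of $L^*$. A *normal form* of $w\in L^*$, $w\neq 1$, is a sequence $g_1\dots g_n$ ($n\ge 1$) of elements of $K\cup L$ with product $w$ such that $g_i,g_{i+1}$ belong to different factors for $1\le i<n$ and, if $n\ne1$, no $g_i$ belongs to $H$. The number $n=|w|$ depends only on $w$ and is the *length* of $w$; the identity has the empty normal form and $|1|=0$. A word $w$ with normal form $g_1\dots g_n$ is *weakly cyclically reduced* if $n\le 1$ or $g_ng_1\notin H$. A representation $w=uv$ is *semireduced* if $u=1$, or $v=1$, or the last letter $g$ of a normal form of $u$ and the first letter $g'$ of a normal form of $v$ satisfy $gg'\notin H$. A set $R\subset L^*$ is *symmetrized* if every $r\in R$ is weakly cyclically reduced and all weakly cyclically reduced conjugates of $r$ and $r^{-1}$ belong to $R$; the *symmetrized closure* of an element is the least symmetrized set containing it. A word $b$ is a *piece* with respect to $R$ if there are different $r,r'\in R$ and $c,c'\in L^*$ such that $r=bc$ and $r'=bc'$ are semireduced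 representations. A symmetrized set $R$ satisfies $C'(\lambda)$, where $\lambda>0$, if $|b|<\lambda|r|$ whenever $r\in R$ has a semireduced representation $r=bc$ with $b$ a piece, and $|r|>1/\lambda$ for all $r\in R$. Elements $x,y\in K$ are *good fellows over $H$* if $x,y\in K\setminus H$ and $Hx^{\varepsilon}H\cap Hy^{\delta}H=\varnothing$ for all $\varepsilon,\delta\in\{1,-1\}$. **Lemma A.2.** Let $x,y\in K$ be good fellows over $H$, let $a\in L\setminus H$ satisfy $a^{-1}Ha\cap H=\{1\}$, and let $h\in K\setminus H$. Let $R\subset L^*$ be the symmetrized closure of $$r_0=h\,a\;ya\;xa\,(ya)^2\;xa\,(ya)^3\cdots xa\,(ya)^{80}.$$ Then $R$ is symmetrized and satisfies the small cancellation condition $C'(1/10)$. Moreover, every piece with respect to $R$ has length at most $601$, and every element of $R$ has length $6640$ or $6641$. -/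

import Mathlib

universe u

/-- Two elements `x`, `y` of a group `G` are good fellows over a subgroup `H` if they lie outside
`H` and the double cosets `H x^ε H` and `H y^δ H` are disjoint for all `ε, δ = ±1`. -/
def GoodFellows {G : Type u} [Group G] (H : Subgroup G) (x y : G) : Prop :=
  x ∉ H ∧ y ∉ H ∧ ∀ ε δ : ℤˣ,
    Disjoint (DoubleCoset.doubleCoset (x ^ (ε : ℤ)) (H : Set G) (H : Set G))
      (DoubleCoset.doubleCoset (y ^ (δ : ℤ)) (H : Set G) (H : Set G))

namespace Amalgam

/-- The two-element family of groups `K`, `L`. -/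
def Factor (K L : Type u) : Bool → Type u
  | false => K
  | true => L

instance (K L : Type u) [Group K] [Group L] : ∀ i, Group (Factor K L i)
  | false => inferInstanceAs (Group K)
  | true => inferInstanceAs (Group L)

variable {K L : Type u} [Group K] [Group L] {H : Subgroup K} {H' : Subgroup L}

/-- The embeddings of the amalgamated subgroup `H` in `K` (the inclusion) and in `L` (the
isomorphism `φ : H ≃* H'` followed by the inclusion). -/
def incl (φ : H ≃* H') : ∀ i, H →* Factor K L i
  | false => H.subtype
  | true => H'.subtype.comp φ.toMonoidHom

/-- The free product of `K` and `L` with the subgroups `H` of `K` and `H'` of `L` amalgamated by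
the isomorphism `φ`: Mathlib's pushout of groups, for the two-element family `K`, `L`. -/
abbrev AmalgamatedProduct (φ : H ≃* H') : Type u := Monoid.PushoutI (incl φ)

/-- The natural homomorphism from `K`. -/
def ofLeft (φ : H ≃* H') : K →* AmalgamatedProduct φ :=
  Monoid.PushoutI.of (φ := incl φ) false

/-- The natural homomorphism from `L`. -/
def ofRight (φ : H ≃* H') : L →* AmalgamatedProduct φ :=
  Monoid.PushoutI.of (φ := incl φ) true

/-- The copy of `K` in the amalgamated product. -/
def left (φ : H ≃* H') : Subgroup (AmalgamatedProduct φ) := (ofLeft φ).range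

/-- The copy of `L` in the amalgamated product. -/
def right (φ : H ≃* H') : Subgroup (AmalgamatedProduct φ) := (ofRight φ).range

/-- The copy of the amalgamated subgroup `H` in the amalgamated product. -/
def base (φ : H ≃* H') : Subgroup (AmalgamatedProduct φ) := H.map (ofLeft φ)

variable {φ : H ≃* H'}

/-- The list of letters `l` is a normal form of `w`: its product is `w`, its terms lie in `K ∪ L`,
consecutive terms lie in different factors, and if there is not exactly one term, then no term lies
in `H`. The last clause makes the empty list the only normal form of the identity. -/
structure IsNormalForm (l : List (AmalgamatedProduct φ)) (w : AmalgamatedProduct φ) : Prop where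
  prod_eq : l.prod = w
  letter : ∀ g ∈ l, g ∈ left φ ∨ g ∈ right φ
  alternating : l.IsChain fun g g' =>
    (g ∈ left φ ∧ g' ∈ right φ) ∨ (g ∈ right φ ∧ g' ∈ left φ)
  notMem_base : l.length ≠ 1 → ∀ g ∈ l, g ∉ base φ
  ne_one : l ≠ [1]

/-- The length `|w|`: the number of letters in a normal form of `w` (all normal forms of `w` have
the same number of letters, so the infimum is over a singleton). -/
noncomputable def length (w : AmalgamatedProduct φ) : ℕ :=
  sInf {n | ∃ l, IsNormalForm l w ∧ l.length = n}

/-- `w` is weakly cyclically reduced: it has a normal form `g₁ … gₙ` with `n ≤ 1` or `gₙ g₁ ∉ H`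
(the choice of the normal form does not matter). -/
def IsWeaklyCyclicallyReduced (w : AmalgamatedProduct φ) : Prop :=
  ∃ l, IsNormalForm l w ∧
    (l.length ≤ 1 ∨ ∀ g ∈ l.getLast?, ∀ g' ∈ l.head?, g * g' ∉ base φ)

/-- The product `u v` is semireduced: the last letter `g` of `u` and the first letter `g'` of `v`
do not cancel, that is, `g g' ∉ H`; they may merge. There is no cancellation when `u = 1` or
`v = 1`. -/
def IsSemireduced (u v : AmalgamatedProduct φ) : Prop :=
  ∀ l m, IsNormalForm l u → IsNormalForm m v →
    ∀ g ∈ l.getLast?, ∀ g' ∈ m.head?, g * g' ∉ base φ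

/-- A set is symmetrized if each of its elements `r` is weakly cyclically reduced and it contains
all weakly cyclically reduced conjugates of `r` and `r⁻¹`. -/
def IsSymmetrized (R : Set (AmalgamatedProduct φ)) : Prop :=
  ∀ r ∈ R, IsWeaklyCyclicallyReduced r ∧
    ∀ s, IsWeaklyCyclicallyReduced s → IsConj r s ∨ IsConj r⁻¹ s → s ∈ R

/-- The symmetrized closure of `r`: the least symmetrized set that contains `r`. -/
def symmetrizedClosure (r : AmalgamatedProduct φ) : Set (AmalgamatedProduct φ) :=
  ⋂₀ {S | IsSymmetrized S ∧ r ∈ S}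

/-- `b` is a piece with respect to `R`: two different elements of `R` have semireduced
representations `b c` and `b c'`. -/
def IsPiece (R : Set (AmalgamatedProduct φ)) (b : AmalgamatedProduct φ) : Prop :=
  ∃ r ∈ R, ∃ r' ∈ R, r ≠ r' ∧ ∃ c c', r = b * c ∧ r' = b * c' ∧
    IsSemireduced b c ∧ IsSemireduced b c'

/-- `R` is a symmetrized set that satisfies the small cancellation condition `C'(lam)`. -/
def SmallCancellation (lam : ℝ) (R : Set (AmalgamatedProduct φ)) : Prop :=
  IsSymmetrized R ∧
  (∀ r ∈ R, ∀ b c, IsPiece R b → r = b * c → IsSemireduced b c →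
    (length b : ℝ) < lam * length r) ∧
  ∀ r ∈ R, 1 / lam < (length r : ℝ)

/-- The word `h a (y a) · x a (y a)² · x a (y a)³ ⋯ x a (y a)⁸⁰`. -/
def relator (φ : H ≃* H') (x y h : K) (a : L) : AmalgamatedProduct φ :=
  ofLeft φ h * ofRight φ a * (ofLeft φ y * ofRight φ a) *
    ((List.range 79).map fun k =>
      ofLeft φ x * ofRight φ a * (ofLeft φ y * ofRight φ a) ^ (k + 2)).prod

end Amalgam

/-!
The left cosets of `H` in `K *_H L` are the edges of the Bass–Serre tree, and the partial products
of a normal form trace a path of such cosets that depends only on the element, up to its last edge.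
A weakly cyclically reduced conjugate of the cyclic word `r₀ ^ ±1` is one of its rotations, up to
conjugation by an element of a factor that does not cancel the first letter. Hence, if two such
elements have a common semireduced prefix, then the letters of two rotations of `r₀ ^ ±1` lie
pairwise in the same double cosets of `H`. A prefix of length at least 602 contains two complete
consecutive blocks `x a (y a)^k` and `x a (y a)^(k + 1)`; since `H x H ∪ H x⁻¹ H` and
`H y H ∪ H y⁻¹ H` are disjoint, the number of letters between the occurrences of `x` identifies the
position in `r₀`, and their growth identifies the sign. So the two rotations coincide. Finally, two
consecutive edges of the path around a letter `a ^ ±1` determine the partial product itself, because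
`a⁻¹ H a ∩ H = 1`, so that the two elements are equal.
-/

namespace Amalgam

section Alternating

variable {G : Type*} [Group G] {F : Bool → Subgroup G} {C : Subgroup G}

/-- The letters of the list avoid `C` and lie alternately in `F i`, `F (!i)`, `F i`, …. For a
list with at least two letters this is a normal form in an amalgam of `F false` and `F true` over
`C`; the one-letter normal forms in `C` are excluded here. -/
def IsAlternating (F : Bool → Subgroup G) (C : Subgroup G) : Bool → List G → Prop
  | _, [] => True
  | i, g :: l => g ∈ F i ∧ g ∉ C ∧ IsAlternating F C (!i) l

/-- An internal characterization of `G` as the free product of `F false` and `F true` with the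
subgroup `C` amalgamated: the factors generate `G`, and no nonempty alternating product lies in
`C`. -/
structure IsAmalgam (F : Bool → Subgroup G) (C : Subgroup G) : Prop where
  le : ∀ i, C ≤ F i
  eq_nil : ∀ i l, IsAlternating F C i l → l.prod ∈ C → l = []
  closure_eq_top : Subgroup.closure ((F false : Set G) ∪ F true) = ⊤

theorem IsAmalgam.mem_of_mem_of_mem (hF : IsAmalgam F C) {g : G} {i : Bool} (hg : g ∈ F i)
    (hg' : g ∈ F (!i)) : g ∈ C := by
  by_contra hgC
  have := hF.eq_nil i [g, g⁻¹] ⟨hg, hgC, inv_mem hg', by simpa using hgC, trivial⟩ (by simp)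
  simp at this

theorem isAlternating_append {l m : List G} {i : Bool} :
    IsAlternating F C i (l ++ m) ↔
      IsAlternating F C i l ∧ IsAlternating F C (i ^^ l.length.bodd) m := by
  induction l generalizing i with
  | nil => simp [IsAlternating]
  | cons g l ih => simp [IsAlternating, ih, and_assoc]

theorem IsAlternating.inv_reverse_append {l m : List G} {i : Bool} (hl : IsAlternating F C i l)
    (hm : IsAlternating F C (!i) m) : ∃ k, IsAlternating F C k ((l.map (·⁻¹)).reverse ++ m) := by
  induction l generalizing i m with
  | nil => exact ⟨_, hm⟩
  | cons g l ih =>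
    obtain ⟨k, hk⟩ := ih (m := g⁻¹ :: m) hl.2.2
      ⟨by simpa using hl.1, by simpa using hl.2.1, by simpa using hm⟩
    exact ⟨k, by simpa using hk⟩

theorem IsAlternating.mul_head (hF : IsAmalgam F C) {g : G} {l : List G} {i : Bool}
    (h : IsAlternating F C i (g :: l)) {c : G} (hc : c ∈ C) :
    IsAlternating F C i (c * g :: l) :=
  ⟨mul_mem (hF.le i hc) h.1, fun h' => h.2.1 ((C.mul_mem_cancel_left hc).1 h'), h.2.2⟩

theorem IsAlternating.eq_nil_of_inv_mul_mem (hF : IsAmalgam F C) {l m : List G} {i : Bool}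
    (hl : IsAlternating F C i l) (hm : IsAlternating F C (!i) m) (h : l.prod⁻¹ * m.prod ∈ C) :
    l = [] ∧ m = [] := by
  obtain ⟨k, hk⟩ := hl.inv_reverse_append hm
  simpa using hF.eq_nil k _ hk (by rwa [List.prod_append, ← List.prod_inv_reverse])

theorem IsAlternating.inv_head_mul_head_mem (hF : IsAmalgam F C) {g g' : G} {l m : List G}
    {i k : Bool} (hl : IsAlternating F C i (g :: l)) (hm : IsAlternating F C k (g' :: m))
    (h : (g :: l).prod = (g' :: m).prod) : k = i ∧ g⁻¹ * g' ∈ C := by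
  obtain rfl : k = i := by
    by_contra hki
    obtain rfl : k = !i := Bool.eq_not_of_ne hki
    simpa using hl.eq_nil_of_inv_mul_mem hF hm (by simp [h])
  refine ⟨rfl, ?_⟩
  by_contra hd
  have hdm : IsAlternating F C (!!k) (g⁻¹ * g' :: m) :=
    ⟨by simpa using mul_mem (inv_mem hl.1) hm.1, hd, by simpa using hm.2.2⟩
  rw [List.prod_cons, List.prod_cons] at h
  simpa using hl.2.2.eq_nil_of_inv_mul_mem hF hdm (by simp [eq_inv_mul_of_mul_eq h, mul_assoc])

/-- The left cosets of `C` are the edges of the Bass–Serre tree of the amalgam, and those of the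
partial products are the path that the word traces in it. -/
theorem IsAlternating.length_eq_and_coset_eq (hF : IsAmalgam F C) {l m : List G} {i k : Bool}
    (hl : IsAlternating F C i l) (hm : IsAlternating F C k m) {c : G} (hc : c ∈ C)
    (h : l.prod = c * m.prod) :
    l.length = m.length ∧
      ∀ j, ((l.take j).prod : G ⧸ C) = (c * (m.take j).prod : G) := by
  induction l generalizing i k m c with
  | nil =>
    obtain rfl : m = [] := hF.eq_nil k m hm (by
      rw [← inv_mul_eq_iff_eq_mul.2 h]
      simpa using hc)
    simpa [QuotientGroup.eq] using hc
  | cons g l ih =>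
    rcases m with _ | ⟨g', m⟩
    · simpa using hF.eq_nil i _ hl (by simpa [h] using hc)
    have hcm : (g :: l).prod = (c * g' :: m).prod := by rw [h]; simp [mul_assoc]
    have hd := (hl.inv_head_mul_head_mem hF (hm.mul_head hF hc) hcm).2
    rw [List.prod_cons, List.prod_cons] at hcm
    obtain ⟨hlen, hcoset⟩ := ih hl.2.2 hm.2.2 hd (by
      simp [eq_inv_mul_of_mul_eq hcm, mul_assoc])
    refine ⟨by simp [hlen], fun j => ?_⟩
    cases j with
    | zero => simpa [QuotientGroup.eq] using hc
    | succ j => simpa [QuotientGroup.eq, mul_assoc] using hcoset j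

theorem IsAlternating.exists_mul_prod_eq {l : List G} {i k : Bool}
    (hl : IsAlternating F C k l) {g : G} (hg : g ∈ F i) :
    ∃ c ∈ C, ∃ i m, IsAlternating F C i m ∧ g * l.prod = c * m.prod := by
  by_cases hgC : g ∈ C
  · exact ⟨g, hgC, k, l, hl, rfl⟩
  by_cases hk : k = !i
  · exact ⟨1, one_mem _, i, g :: l, ⟨hg, hgC, hk ▸ hl⟩, by simp⟩
  obtain rfl : k = i := by simpa using Bool.eq_not_of_ne hk
  rcases l with _ | ⟨u, l⟩
  · exact ⟨1, one_mem _, k, [g], ⟨hg, hgC, trivial⟩, by simp⟩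
  by_cases hu : g * u ∈ C
  · exact ⟨g * u, hu, _, l, hl.2.2, by simp [mul_assoc]⟩
  · exact ⟨1, one_mem _, k, g * u :: l, ⟨mul_mem hg hl.1, hu, hl.2.2⟩, by simp [mul_assoc]⟩

theorem IsAmalgam.exists_isAlternating (hF : IsAmalgam F C) (w : G) :
    ∃ c ∈ C, ∃ i l, IsAlternating F C i l ∧ w = c * l.prod := by
  have mul_left : ∀ i, ∀ g ∈ F i, ∀ w, (∃ c ∈ C, ∃ i l, IsAlternating F C i l ∧ w = c * l.prod) →
      ∃ c ∈ C, ∃ i l, IsAlternating F C i l ∧ g * w = c * l.prod := by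
    rintro i g hg _ ⟨c, hc, k, l, hl, rfl⟩
    simpa only [mul_assoc] using hl.exists_mul_prod_eq (mul_mem hg (hF.le i hc))
  have hw : w ∈ Subgroup.closure ((F false : Set G) ∪ F true) :=
    hF.closure_eq_top ▸ Subgroup.mem_top w
  induction hw using Subgroup.closure_induction_left with
  | one => exact ⟨1, one_mem _, true, [], trivial, by simp⟩
  | mul_left g hg w _ ih => exact hg.elim (mul_left _ g · w ih) (mul_left _ g · w ih)
  | inv_mul_cancel g hg w _ ih =>
    exact hg.elim (fun h => mul_left _ _ (inv_mem h) w ih) fun h => mul_left _ _ (inv_mem h) w ih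

theorem IsAlternating.last_mul_head_mem (hF : IsAmalgam F C) {i k : Bool} {l m : List G}
    {g g' u u' : G} (hl : IsAlternating F C i (g :: l ++ [g']))
    (hm : IsAlternating F C k (u :: m ++ [u'])) (h : (g :: l ++ [g']).prod = (u :: m ++ [u']).prod)
    (hgg' : g' * g ∈ C) : u' * u ∈ C := by
  obtain ⟨hlen, hcoset⟩ := hl.length_eq_and_coset_eq hF hm (one_mem C) (by simpa using h)
  have hhead : g⁻¹ * u ∈ C := by simpa [QuotientGroup.eq] using hcoset 1
  have hlast : (g :: l).prod⁻¹ * (u :: m).prod ∈ C := by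
    have := hcoset (g :: l).length
    rwa [List.take_left, show (g :: l).length = (u :: m).length by simpa using hlen,
      List.take_left, one_mul, QuotientGroup.eq] at this
  rw [List.prod_append, List.prod_append, List.prod_singleton, List.prod_singleton] at h
  have hu' : u' = ((g :: l).prod⁻¹ * (u :: m).prod)⁻¹ * g' := by
    rw [eq_comm, mul_inv_rev, inv_inv, mul_assoc, h]
    group
  have : u' * u = ((g :: l).prod⁻¹ * (u :: m).prod)⁻¹ * (g' * g) * (g⁻¹ * u) := by
    rw [hu']
    group
  rw [this]
  exact mul_mem (mul_mem (inv_mem hlast) hgg') hhead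

/-- In a semireduced product only the last letter of the left factor changes, as it may absorb an
element of `C` or merge with the first letter of the right factor. -/
theorem IsAlternating.exists_append_prod_eq (hF : IsAmalgam F C) {i : Bool} {l : List G} {g w : G}
    (hl : IsAlternating F C i (l ++ [g]))
    (hw : ∀ k g' m, IsAlternating F C k (g' :: m) → (g' :: m).prod = w → g * g' ∉ C) :
    ∃ m, IsAlternating F C i (l ++ m) ∧ (l ++ m).prod = (l ++ [g]).prod * w := by
  simp only [isAlternating_append] at hl ⊢
  obtain ⟨hl, hg, hgC, -⟩ := hl
  set k := i ^^ l.length.bodd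
  obtain ⟨c, hc, k', m, hm, rfl⟩ := hF.exists_isAlternating w
  rcases m with _ | ⟨g', m⟩
  · refine ⟨[g * c], ⟨hl, mul_mem hg (hF.le k hc), ?_, trivial⟩, by simp [mul_assoc]⟩
    rwa [C.mul_mem_cancel_right hc]
  replace hm := hm.mul_head hF hc
  by_cases hk : k' = k
  · subst hk
    exact ⟨g * (c * g') :: m,
      ⟨hl, mul_mem hg hm.1, hw _ _ m hm (by simp [mul_assoc]), hm.2.2⟩, by simp [mul_assoc]⟩
  · exact ⟨g :: c * g' :: m, ⟨hl, hg, hgC, Bool.eq_not_of_ne hk ▸ hm⟩, by simp [mul_assoc]⟩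

end Alternating

section Segments

variable {α : Type*} (s : ℤ → α) (i : ℤ)

/-- The list of the `n` consecutive terms of a bi-infinite sequence from the `i`-th on. -/
def seg (n : ℕ) : List α :=
  (List.range n).map fun j : ℕ => s (i + j)

theorem length_seg (n : ℕ) : (seg s i n).length = n := by
  simp [seg]

theorem seg_add (m n : ℕ) : seg s i (m + n) = seg s i m ++ seg s (i + m) n := by
  simp [seg, List.range_add, add_assoc, Function.comp_def]

theorem seg_succ (n : ℕ) : seg s i (n + 1) = s i :: seg s (i + 1) n := by
  rw [add_comm, seg_add]
  simp [seg]

theorem seg_succ_right (n : ℕ) : seg s i (n + 1) = seg s i n ++ [s (i + n)] := by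
  rw [seg_add]
  simp [seg]

theorem take_seg {m n : ℕ} (h : m ≤ n) : (seg s i n).take m = seg s i m := by
  rw [seg, ← List.map_take, List.take_range, min_eq_left h, seg]

theorem seg_add_period {c : ℤ} (hs : Function.Periodic s c) (n : ℕ) :
    seg s (i + c) n = seg s i n := by
  simp only [seg, add_right_comm i c, hs _]

end Segments

section CyclicWords

variable {G : Type*} [Group G] {F : Bool → Subgroup G} {C : Subgroup G} {s : ℤ → G} {n : ℕ}

/-- The bi-infinite sequence of inverse letters read backwards. -/
def invSeq (s : ℤ → G) (q : ℤ) : G :=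
  (s (-q))⁻¹

theorem prod_seg_invSeq (s : ℤ → G) (i : ℤ) (n : ℕ) :
    (seg (invSeq s) i n).prod = (seg s (1 - i - n) n).prod⁻¹ := by
  induction n with
  | zero => simp [seg]
  | succ n ih =>
    rw [seg_succ_right, seg_succ, List.prod_append, ih, List.prod_singleton, List.prod_cons,
      mul_inv_rev, invSeq]
    rw [show 1 - i - ((n + 1 : ℕ) : ℤ) = -(i + n) by grind,
      show -(i + n : ℤ) + 1 = 1 - i - n by ring]

/-- A cyclic word of `n` letters alternately in `F false` and `F true`, none of them in `C`. It is
unrolled to an `n`-periodic bi-infinite sequence, so that its cyclic rotations are segments. -/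
structure IsCyclicWord (F : Bool → Subgroup G) (C : Subgroup G) (s : ℤ → G) (n : ℕ) : Prop where
  mem : ∀ q, s q ∈ F q.bodd
  notMem : ∀ q, s q ∉ C
  periodic : Function.Periodic s n
  ne_zero : n ≠ 0

namespace IsCyclicWord

theorem inv (hs : IsCyclicWord F C s n) : IsCyclicWord F C (invSeq s) n where
  mem q := by simpa [invSeq] using hs.mem (-q)
  notMem q := by simpa [invSeq] using hs.notMem (-q)
  periodic q := by rw [invSeq, neg_add', hs.periodic.sub_eq, invSeq]
  ne_zero := hs.ne_zero

theorem bodd_eq_false (hs : IsCyclicWord F C s n) (hF : IsAmalgam F C) : n.bodd = false := by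
  by_contra hn
  have h := hs.mem (0 + n)
  rw [hs.periodic] at h
  exact hs.notMem 0 (hF.mem_of_mem_of_mem (hs.mem 0) (by simpa [hn] using h))

theorem two_le (hs : IsCyclicWord F C s n) (hF : IsAmalgam F C) : 2 ≤ n := by
  have := hs.ne_zero
  have : n ≠ 1 := by
    rintro rfl
    simpa using hs.bodd_eq_false hF
  omega

theorem isAlternating_seg_append (hs : IsCyclicWord F C s n) {i : ℤ} {m : ℕ} {l : List G}
    (hl : IsAlternating F C (i + m).bodd l) : IsAlternating F C i.bodd (seg s i m ++ l) := by
  induction m generalizing i with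
  | zero => simpa [seg] using hl
  | succ m ih =>
    rw [seg_succ, List.cons_append]
    refine ⟨hs.mem i, hs.notMem i, ?_⟩
    have := ih (i := i + 1) (by rwa [add_assoc, add_comm 1, ← Nat.cast_succ])
    simpa using this

theorem conj_prod_seg (hs : IsCyclicWord F C s n) (i : ℤ) (j : ℕ) :
    (seg s i n).prod = (seg s i j).prod * (seg s (i + j) n).prod * (seg s i j).prod⁻¹ := by
  rw [eq_mul_inv_iff_mul_eq, ← List.prod_append, ← List.prod_append, ← seg_add, add_comm j n,
    seg_add, seg_add_period s i hs.periodic]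

theorem conj_prod_seg_one (hs : IsCyclicWord F C s n) (i : ℤ) :
    (seg s i n).prod = s i * (seg s (i + 1) n).prod * (s i)⁻¹ := by
  simpa [seg] using hs.conj_prod_seg i 1

end IsCyclicWord

/-- In no normal form of `w` with at least two letters do the last and the first letter cancel. -/
def IsCyclicallyReduced (F : Bool → Subgroup G) (C : Subgroup G) (w : G) : Prop :=
  ∀ i g l g', IsAlternating F C i (g :: l ++ [g']) → (g :: l ++ [g']).prod = w → g' * g ∉ C

/-- The shape of the cyclically reduced conjugates of a cyclic word `s` with `n` letters: `w` is the
rotation of the word that starts at `i`, conjugated by an element `b` of the factor of the first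
letter that does not cancel this letter. -/
def IsShift (F : Bool → Subgroup G) (C : Subgroup G) (s : ℤ → G) (n : ℕ) (w : G) (i : ℤ)
    (b : G) : Prop :=
  w = b * (seg s i n).prod * b⁻¹ ∧ b ∈ F i.bodd ∧ b * s i ∉ C

theorem IsShift.exists_isAlternating (hF : IsAmalgam F C) (hs : IsCyclicWord F C s n) {w : G}
    {i : ℤ} {b : G} (h : IsShift F C s n w i b) :
    ∃ t, IsAlternating F C i.bodd (b * s i :: (seg s (i + 1) (n - 2) ++ t)) ∧
      (b * s i :: (seg s (i + 1) (n - 2) ++ t)).prod = w ∧ (t.length = 1 ∨ t.length = 2) := by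
  obtain ⟨rfl, hb, hbs⟩ := h
  obtain ⟨n, rfl⟩ := Nat.exists_eq_add_of_le' (hs.two_le hF)
  have hn : n.bodd = false := by simpa using hs.bodd_eq_false hF
  have hseg : (seg s i (n + 2)).prod = s i * (seg s (i + 1) n).prod * s (i + 1 + n) := by
    rw [seg_succ, seg_succ_right]
    simp [mul_assoc]
  have hlast := hs.mem (i + 1 + n)
  have append : ∀ t, IsAlternating F C (i + 1 + n).bodd t →
      IsAlternating F C i.bodd (b * s i :: (seg s (i + 1) n ++ t)) := fun t ht =>
    ⟨mul_mem hb (hs.mem i), hbs, by simpa using hs.isAlternating_seg_append ht⟩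
  by_cases hbC : b ∈ C
  · refine ⟨[s (i + 1 + n) * b⁻¹], append _ ⟨?_, ?_, trivial⟩, ?_, Or.inl rfl⟩
    · exact mul_mem hlast (inv_mem (hF.le _ hbC))
    · rw [C.mul_mem_cancel_right (inv_mem hbC)]
      exact hs.notMem _
    · simp [hseg, mul_assoc]
  · refine ⟨[s (i + 1 + n), b⁻¹], append _ ⟨hlast, hs.notMem _, ?_, ?_, trivial⟩, ?_, Or.inr rfl⟩
    · simpa [hn] using hb
    · simpa using hbC
    · simp [hseg, mul_assoc]

theorem IsCyclicWord.isShift_of_notMem (hs : IsCyclicWord F C s n) (hF : IsAmalgam F C) {w : G}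
    (hw : IsCyclicallyReduced F C w) {i : ℤ} {u : G} {l : List G}
    (hl : IsAlternating F C i.bodd (u :: l)) (hu : u⁻¹ * s i ∉ C)
    (h : w = (u :: l).prod⁻¹ * (seg s i n).prod * (u :: l).prod) : IsShift F C s n w i u⁻¹ := by
  rcases List.eq_nil_or_concat' l with rfl | ⟨l, v, rfl⟩
  · exact ⟨by simpa using h, by simpa using hl.1, hu⟩
  obtain ⟨n, rfl⟩ := Nat.exists_eq_succ_of_ne_zero hs.ne_zero
  have hn : n.succ.bodd = false := hs.bodd_eq_false hF
  have hmid : IsAlternating F C i.bodd (u⁻¹ * s i :: (seg s (i + 1) n ++ (u :: (l ++ [v])))) := by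
    refine ⟨mul_mem (inv_mem hl.1) (hs.mem i), hu, ?_⟩
    have := hs.isAlternating_seg_append (i := i + 1) (m := n) (l := u :: (l ++ [v]))
      (by rwa [add_assoc, add_comm 1, ← Nat.cast_succ, Int.bodd_add, Int.bodd_coe, hn,
        Bool.xor_false])
    simpa using this
  obtain ⟨k, hk⟩ := hl.2.2.inv_reverse_append (by simpa using hmid)
  refine absurd ?_ (hw k v⁻¹ ((l.map (·⁻¹)).reverse ++ u⁻¹ * s i :: (seg s (i + 1) n ++ u :: l)) v
    (by simpa using hk) ?_)
  · simp
  · rw [h, seg_succ]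
    simp [List.prod_inv_reverse, mul_assoc]

theorem IsCyclicWord.exists_isShift_of_eq_conj (hs : IsCyclicWord F C s n) (hF : IsAmalgam F C)
    {w : G} (hw : IsCyclicallyReduced F C w) {l : List G} {k : Bool} (hl : IsAlternating F C k l)
    {c : G} (hc : c ∈ C) {i : ℤ}
    (h : w = (c * l.prod)⁻¹ * (seg s i n).prod * (c * l.prod)) :
    ∃ i b, IsShift F C s n w i b := by
  induction l generalizing k c i with
  | nil =>
    refine ⟨i, c⁻¹, by simpa using h, hF.le _ (inv_mem hc), ?_⟩
    rw [C.mul_mem_cancel_left (inv_mem hc)]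
    exact hs.notMem i
  | cons u l ih =>
    replace hl := hl.mul_head hF hc
    replace h : w = (c * u :: l).prod⁻¹ * (seg s i n).prod * (c * u :: l).prod := by
      simpa [mul_assoc] using h
    generalize c * u = u at hl h
    by_cases hk : k = i.bodd
    · subst hk
      by_cases hu : u⁻¹ * s i ∈ C
      · refine ih hl.2.2 (inv_mem hu) (i := i + 1) ?_
        rw [h, hs.conj_prod_seg_one i, List.prod_cons]
        group
      · exact ⟨i, _, hs.isShift_of_notMem hF hw hl hu h⟩
    · obtain rfl : k = (i - 1).bodd := by
        simpa [sub_eq_add_neg] using Bool.eq_not_of_ne hk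
      have hconj := hs.conj_prod_seg_one (i - 1)
      rw [sub_add_cancel] at hconj
      by_cases hu : s (i - 1) * u ∈ C
      · refine ih hl.2.2 hu (i := i - 1) ?_
        rw [h, hconj, List.prod_cons]
        group
      · refine ⟨i - 1, _, hs.isShift_of_notMem hF hw (u := s (i - 1) * u) (l := l)
          ⟨mul_mem (hs.mem _) hl.1, hu, hl.2.2⟩ (by simpa using hl.2.1) ?_⟩
        rw [h, hconj, List.prod_cons, List.prod_cons]
        group

theorem IsCyclicWord.exists_isShift (hs : IsCyclicWord F C s n) (hF : IsAmalgam F C) {w : G}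
    (hw : IsCyclicallyReduced F C w) {i : ℤ} (hconj : IsConj (seg s i n).prod w) :
    ∃ i b, IsShift F C s n w i b := by
  obtain ⟨z, hz⟩ := isConj_iff.1 hconj
  obtain ⟨c, hc, k, l, hl, hcl⟩ := hF.exists_isAlternating z⁻¹
  exact hs.exists_isShift_of_eq_conj hF hw hl hc (i := i) (by rw [← hcl, ← hz, inv_inv])

theorem IsShift.eq_conj (hs : IsCyclicWord F C s n) {w : G} {i : ℤ} {b : G}
    (h : IsShift F C s n w i b) (j : ℕ) :
    w = b * (seg s i j).prod * (seg s (i + j) n).prod * (b * (seg s i j).prod)⁻¹ := by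
  rw [h.1, hs.conj_prod_seg i j]
  group

theorem IsShift.coset_eq (hF : IsAmalgam F C) (hs : IsCyclicWord F C s n) {i : ℤ} {b : G}
    {l : List G} {k : Bool} (hl : IsAlternating F C k l) (h : IsShift F C s n l.prod i b) {j : ℕ}
    (hj : j + 1 < n) :
    ((l.take (j + 1)).prod : G ⧸ C) = (b * (seg s i (j + 1)).prod : G) := by
  obtain ⟨t, ht, hprod, -⟩ := h.exists_isAlternating hF hs
  have := (hl.length_eq_and_coset_eq hF ht (one_mem C) (by rw [one_mul, hprod])).2 (j + 1)
  rwa [List.take_succ_cons, List.take_append_of_le_length (by rw [length_seg]; omega),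
    take_seg _ _ (by omega), List.prod_cons, one_mul, mul_assoc, ← List.prod_cons,
    ← seg_succ] at this

end CyclicWords

section Rigidity

variable {G : Type*} [Group G] {F : Bool → Subgroup G} {C : Subgroup G} {s : ℤ → G} {n M : ℕ}

theorem mem_doubleCoset_of_coset_eq {x x' g g' : G} (hx : (x : G ⧸ C) = x')
    (hg : ((x * g : G) : G ⧸ C) = (x' * g' : G)) : g' ∈ DoubleCoset.doubleCoset g C C := by
  rw [QuotientGroup.eq] at hx hg
  exact DoubleCoset.mem_doubleCoset.2 ⟨_, inv_mem hx, _, hg, by group⟩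

/-- The conjugate `g⁻¹ C g` meets `C` trivially. -/
def MeetsConjTrivially (C : Subgroup G) (g : G) : Prop :=
  ∀ c ∈ C, g⁻¹ * c * g ∈ C → c = 1

theorem MeetsConjTrivially.inv {g : G} (hg : MeetsConjTrivially C g) :
    MeetsConjTrivially C g⁻¹ := fun c hc hgc => by
  simpa using hg _ hgc (by simpa [mul_assoc] using hc)

theorem MeetsConjTrivially.eq_of_coset_eq {x x' g : G} (hg : MeetsConjTrivially C g)
    (hx : (x : G ⧸ C) = x') (hxg : ((x * g : G) : G ⧸ C) = (x' * g : G)) : x = x' := by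
  rw [QuotientGroup.eq] at hx hxg
  exact inv_mul_eq_one.1 (hg _ hx (by simpa [mul_assoc] using hxg))

theorem IsAmalgam.eq_of_mem_doubleCoset (hF : IsAmalgam F C) {i k : Bool} {g g' : G} (hg : g ∈ F i)
    (hg' : g' ∈ F k) (hgC : g' ∉ C) (h : g' ∈ DoubleCoset.doubleCoset g C C) : k = i := by
  obtain ⟨c, hc, d, hd, rfl⟩ := DoubleCoset.mem_doubleCoset.1 h
  by_contra hk
  obtain rfl : k = !i := Bool.eq_not_of_ne hk
  exact hgC (hF.mem_of_mem_of_mem (mul_mem (mul_mem (hF.le i hc) hg) (hF.le i hd)) hg')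

/-- The double cosets of any `M` consecutive letters of the `n`-periodic sequence `s` determine
their position modulo `n`, and tell `s` from the sequence of inverse letters read backwards. -/
structure IsRigid (C : Subgroup G) (s : ℤ → G) (n M : ℕ) : Prop where
  dvd : ∀ i d : ℤ, (∀ j ∈ Set.Ico i (i + M), s (j + d) ∈ DoubleCoset.doubleCoset (s j) C C) →
    (n : ℤ) ∣ d
  not_inv : ∀ i d : ℤ, ¬ ∀ j ∈ Set.Ico i (i + M),
    (s (d - j))⁻¹ ∈ DoubleCoset.doubleCoset (s j) C C

theorem inv_mem_doubleCoset_iff {g g' : G} :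
    g'⁻¹ ∈ DoubleCoset.doubleCoset g C C ↔ g' ∈ DoubleCoset.doubleCoset g⁻¹ C C := by
  simp only [DoubleCoset.mem_doubleCoset, SetLike.mem_coe]
  constructor <;> rintro ⟨c, hc, d, hd, h⟩ <;>
    exact ⟨d⁻¹, inv_mem hd, c⁻¹, inv_mem hc, inv_injective (by simpa [mul_assoc] using h)⟩

theorem IsRigid.pos (hr : IsRigid C s n M) : 0 < M := by
  by_contra! hM
  exact hr.not_inv 0 0 fun j hj => by grind

theorem IsRigid.inv (hr : IsRigid C s n M) : IsRigid C (invSeq s) n M where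
  dvd i d h := by
    refine (dvd_neg).1 (hr.dvd (1 - i - M) (-d) fun j hj => ?_)
    have := h (-j) ⟨by grind, by grind⟩
    rw [invSeq, invSeq, inv_mem_doubleCoset_iff, inv_inv] at this
    convert this using 2 <;> ring_nf
  not_inv i d h := by
    refine hr.not_inv (1 - i - M) (-d) fun j hj => ?_
    have := h (-j) ⟨by grind, by grind⟩
    rw [invSeq, invSeq, inv_inv, ← inv_mem_doubleCoset_iff, neg_neg] at this
    convert this using 3
    ring

theorem mem_doubleCoset_of_seg_coset_eq {s' : ℤ → G} {b b' : G} {i i' : ℤ}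
    (h : ∀ j ≤ M, ((b * (seg s i (j + 1)).prod : G) : G ⧸ C) =
      (b' * (seg s' i' (j + 1)).prod : G)) :
    ∀ j ∈ Set.Ico (i + 1) (i + 1 + M), s' (j + (i' - i)) ∈ DoubleCoset.doubleCoset (s j) C C := by
  intro q hq
  obtain ⟨j, rfl⟩ : ∃ j : ℕ, q = i + (j + 1 : ℕ) := ⟨(q - i - 1).toNat, by grind⟩
  have hj : j + 1 ≤ M := by grind
  have hsucc := h (j + 1) hj
  rw [seg_succ_right s, seg_succ_right s', List.prod_append, List.prod_append,
    List.prod_singleton, List.prod_singleton, ← mul_assoc, ← mul_assoc] at hsucc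
  convert mem_doubleCoset_of_coset_eq (h j (by omega)) hsucc using 2
  ring

theorem IsRigid.shift_eq_of_coset_eq (hr : IsRigid C s n M) (hs : IsCyclicWord F C s n)
    (hC : ∀ i : ℤ, ∃ j ∈ Set.Ico i (i + M), MeetsConjTrivially C (s j)) {w w' b b' : G} {i i' : ℤ}
    (hw : IsShift F C s n w i b) (hw' : IsShift F C s n w' i' b')
    (h : ∀ j ≤ M, ((b * (seg s i (j + 1)).prod : G) : G ⧸ C) =
      (b' * (seg s i' (j + 1)).prod : G)) : w = w' := by
  obtain ⟨m, hm⟩ : (n : ℤ) ∣ i' - i := hr.dvd _ _ (mem_doubleCoset_of_seg_coset_eq h)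
  have hseg : ∀ j : ℤ, seg s (i' + j) = seg s (i + j) := fun j => by
    ext1 k
    rw [show i' + j = i + j + m * n by linear_combination hm]
    exact seg_add_period s _ (hs.periodic.int_mul m) k
  replace h : ∀ j ≤ M, ((b * (seg s i (j + 1)).prod : G) : G ⧸ C) =
      (b' * (seg s i (j + 1)).prod : G) := by
    have hi := hseg 0
    rw [add_zero, add_zero] at hi
    rwa [hi] at h
  obtain ⟨q, hq, hqC⟩ := hC (i + 1)
  obtain ⟨j, rfl⟩ : ∃ j : ℕ, q = i + (j + 1 : ℕ) := ⟨(q - i - 1).toNat, by grind⟩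
  have hj : j + 1 ≤ M := by grind
  have hsucc := h (j + 1) hj
  rw [seg_succ_right s, List.prod_append, List.prod_singleton, ← mul_assoc, ← mul_assoc] at hsucc
  rw [hw.eq_conj hs (j + 1), hw'.eq_conj hs (j + 1), hseg, ← add_zero i', hseg, add_zero,
    hqC.eq_of_coset_eq (h j (by omega)) hsucc]

theorem IsRigid.seg_coset_ne_invSeq (hr : IsRigid C s n M) {b b' : G} {i i' : ℤ} :
    ¬ ∀ j ≤ M, ((b * (seg s i (j + 1)).prod : G) : G ⧸ C) =
      (b' * (seg (invSeq s) i' (j + 1)).prod : G) := fun h =>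
  hr.not_inv (i + 1) (i - i') fun j hj => by
    convert mem_doubleCoset_of_seg_coset_eq h j hj using 1
    rw [invSeq]
    ring_nf

theorem IsRigid.prod_eq_of_isShift (hr : IsRigid C s n M) (hF : IsAmalgam F C)
    (hs : IsCyclicWord F C s n)
    (hC : ∀ i : ℤ, ∃ j ∈ Set.Ico i (i + M), MeetsConjTrivially C (s j)) (hM : M + 1 < n)
    {l m m' : List G} (hl : M + 1 ≤ l.length) {k k' : Bool} (hm : IsAlternating F C k (l ++ m))
    (hm' : IsAlternating F C k' (l ++ m')) {t t' : ℤ → G}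
    (ht : t = s ∨ t = invSeq s) (ht' : t' = s ∨ t' = invSeq s) {i i' : ℤ} {b b' : G}
    (h : IsShift F C t n (l ++ m).prod i b) (h' : IsShift F C t' n (l ++ m').prod i' b') :
    (l ++ m).prod = (l ++ m').prod := by
  have hCinv : ∀ i : ℤ, ∃ j ∈ Set.Ico i (i + M),
      MeetsConjTrivially C (invSeq s j) := fun i => by
    obtain ⟨j, hj, hjC⟩ := hC (1 - i - M)
    exact ⟨-j, by grind, by simpa [invSeq] using hjC.inv⟩
  have coset : ∀ {t : ℤ → G} {m : List G} {k i b}, t = s ∨ t = invSeq s →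
      IsAlternating F C k (l ++ m) → IsShift F C t n (l ++ m).prod i b → ∀ j ≤ M,
        ((l.take (j + 1)).prod : G ⧸ C) = (b * (seg t i (j + 1)).prod : G) := by
    intro t m k i b ht hm h j hj
    have ht : IsCyclicWord F C t n := by
      rcases ht with rfl | rfl
      exacts [hs, hs.inv]
    rw [← h.coset_eq hF ht hm (by omega), List.take_append_of_le_length (by omega)]
  have hcoset : ∀ j ≤ M, ((b * (seg t i (j + 1)).prod : G) : G ⧸ C) =
      (b' * (seg t' i' (j + 1)).prod : G) := fun j hj =>
    (coset ht hm h j hj).symm.trans (coset ht' hm' h' j hj)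
  rcases ht with rfl | rfl <;> rcases ht' with rfl | rfl
  · exact hr.shift_eq_of_coset_eq hs hC h h' hcoset
  · exact (hr.seg_coset_ne_invSeq hcoset).elim
  · exact (hr.seg_coset_ne_invSeq fun j hj => (hcoset j hj).symm).elim
  · exact hr.inv.shift_eq_of_coset_eq hs.inv hCinv h h' hcoset

end Rigidity

section NormalForms

variable {K L : Type u} [Group K] [Group L] {H : Subgroup K} {H' : Subgroup L} (φ : H ≃* H')

theorem incl_injective (i : Bool) : Function.Injective (incl φ i) := by
  cases i
  · exact H.subtype_injective
  · exact H'.subtype_injective.comp φ.injective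

/-- The copies of `K` (for `false`) and `L` (for `true`) in the amalgamated product. -/
def factor (i : Bool) : Subgroup (AmalgamatedProduct φ) :=
  (Monoid.PushoutI.of (φ := incl φ) i).range

theorem base_eq_range : base φ = (Monoid.PushoutI.base (incl φ)).range := by
  rw [base, ← Monoid.PushoutI.of_comp_eq_base (φ := incl φ) false, MonoidHom.range_comp]
  congr 1
  exact H.range_subtype.symm

theorem base_le_factor (i : Bool) : base φ ≤ factor φ i := by
  rw [base_eq_range, ← Monoid.PushoutI.of_comp_eq_base (φ := incl φ) i]
  rintro _ ⟨c, rfl⟩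
  exact ⟨incl φ i c, rfl⟩

theorem closure_factors :
    Subgroup.closure ((factor φ false : Set (AmalgamatedProduct φ)) ∪ factor φ true) = ⊤ := by
  rw [eq_top_iff]
  rintro w -
  induction w using Monoid.PushoutI.induction_on with
  | of i g =>
    refine Subgroup.subset_closure ?_
    cases i
    exacts [Or.inl ⟨g, rfl⟩, Or.inr ⟨g, rfl⟩]
  | base c =>
    rw [← Monoid.PushoutI.of_apply_eq_base _ false]
    exact Subgroup.subset_closure (Or.inl ⟨_, rfl⟩)
  | mul v w hv hw => exact mul_mem hv hw

theorem IsAlternating.exists_word {i : Bool} {l : List (AmalgamatedProduct φ)}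
    (hl : IsAlternating (factor φ) (base φ) i l) :
    ∃ t : List (Σ i, Factor K L i), t.map (fun p => Monoid.PushoutI.of (φ := incl φ) p.1 p.2) = l ∧
      t.IsChain (fun p q => p.1 ≠ q.1) ∧
      (∀ p ∈ t, Monoid.PushoutI.of (φ := incl φ) p.1 p.2 ∉ base φ) ∧ ∀ p ∈ t.head?, p.1 = i := by
  induction l generalizing i with
  | nil => exact ⟨[], by simp⟩
  | cons g l ih =>
    obtain ⟨t, rfl, hchain, hbase, hhead⟩ := ih hl.2.2
    obtain ⟨g, rfl⟩ := hl.1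
    refine ⟨⟨i, g⟩ :: t, rfl, ?_, by simpa using ⟨hl.2.1, hbase⟩, by simp⟩
    rw [List.isChain_cons]
    exact ⟨fun p hp => by simp [hhead p hp], hchain⟩

theorem IsAlternating.eq_nil_of_prod_mem_base {i : Bool} {l : List (AmalgamatedProduct φ)}
    (hl : IsAlternating (factor φ) (base φ) i l) (h : l.prod ∈ base φ) : l = [] := by
  obtain ⟨t, rfl, hchain, hbase, -⟩ := hl.exists_word
  have hreduced : ∀ p ∈ t, p.2 ∉ (incl φ p.1).range := by
    rintro p hp ⟨c, hc⟩
    refine hbase p hp ?_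
    rw [← hc, Monoid.PushoutI.of_apply_eq_base, base_eq_range]
    exact ⟨c, rfl⟩
  have hempty := Monoid.PushoutI.Reduced.eq_empty_of_mem_range (incl_injective φ)
    (w := ⟨t, fun p hp h1 => hreduced p hp (h1 ▸ one_mem _), hchain⟩) hreduced (by
      rw [← base_eq_range]
      convert h
      simp only [Monoid.CoprodI.Word.prod, map_list_prod, List.map_map]
      congr 1)
  have ht : t = [] := congrArg Monoid.CoprodI.Word.toList hempty
  simp [ht]

theorem isAmalgam_factor_base : IsAmalgam (factor φ) (base φ) where
  le := base_le_factor φ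
  eq_nil _ _ hl h := hl.eq_nil_of_prod_mem_base φ h
  closure_eq_top := closure_factors φ

variable {φ} {i : Bool} {g b c r w : AmalgamatedProduct φ} {l m : List (AmalgamatedProduct φ)}

theorem isAlternating_of_isChain (hg : g ∈ factor φ i)
    (hchain : (g :: l).IsChain fun g g' =>
      (g ∈ left φ ∧ g' ∈ right φ) ∨ (g ∈ right φ ∧ g' ∈ left φ))
    (hbase : ∀ u ∈ g :: l, u ∉ base φ) : IsAlternating (factor φ) (base φ) i (g :: l) := by
  induction l generalizing g i with
  | nil => exact ⟨hg, hbase g (by simp), trivial⟩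
  | cons g' l ih =>
    rw [List.isChain_cons_cons] at hchain
    have hgb := hbase g (by simp)
    have hnot : g ∉ factor φ (!i) := fun h =>
      hgb ((isAmalgam_factor_base φ).mem_of_mem_of_mem hg h)
    refine ⟨hg, hgb, ih ?_ hchain.2 fun u hu => hbase u (by simp [hu])⟩
    rcases hchain.1 with ⟨h, h'⟩ | ⟨h, h'⟩ <;> cases i
    exacts [h', absurd h hnot, absurd h hnot, h']

theorem IsNormalForm.isAlternating_or (h : IsNormalForm l w) :
    (∃ i, IsAlternating (factor φ) (base φ) i l) ∨ ∃ c ∈ base φ, c ≠ 1 ∧ l = [c] := by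
  rcases l with _ | ⟨g, l⟩
  · exact Or.inl ⟨true, trivial⟩
  obtain ⟨i, hi⟩ : ∃ i, g ∈ factor φ i :=
    (h.letter g (by simp)).elim (fun h => ⟨false, h⟩) fun h => ⟨true, h⟩
  rcases l with _ | ⟨g', l⟩
  · by_cases hg : g ∈ base φ
    · exact Or.inr ⟨g, hg, fun h1 => h.ne_one (by rw [h1]), rfl⟩
    · exact Or.inl ⟨i, hi, hg, trivial⟩
  · exact Or.inl ⟨i, isAlternating_of_isChain hi h.alternating (h.notMem_base (by simp))⟩

theorem IsNormalForm.exists_isAlternating (h : IsNormalForm l w) (hl : l.length ≠ 1) :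
    ∃ i, IsAlternating (factor φ) (base φ) i l := by
  rcases h.isAlternating_or with h | ⟨c, -, -, rfl⟩
  exacts [h, absurd rfl hl]

theorem IsAlternating.letter_mem (h : IsAlternating (factor φ) (base φ) i l) :
    ∀ g ∈ l, (g ∈ left φ ∨ g ∈ right φ) ∧ g ∉ base φ := by
  induction l generalizing i with
  | nil => simp
  | cons g l ih =>
    refine List.forall_mem_cons.2 ⟨⟨?_, h.2.1⟩, ih h.2.2⟩
    cases i
    exacts [Or.inl h.1, Or.inr h.1]

theorem IsAlternating.isChain (h : IsAlternating (factor φ) (base φ) i l) :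
    l.IsChain fun g g' => (g ∈ left φ ∧ g' ∈ right φ) ∨ (g ∈ right φ ∧ g' ∈ left φ) := by
  induction l generalizing i with
  | nil => simp
  | cons g l ih =>
    rcases l with _ | ⟨g', l⟩
    · simp
    refine List.isChain_cons_cons.2 ⟨?_, ih h.2.2⟩
    cases i
    exacts [Or.inl ⟨h.1, h.2.2.1⟩, Or.inr ⟨h.1, h.2.2.1⟩]

theorem IsAlternating.isNormalForm (h : IsAlternating (factor φ) (base φ) i l) :
    IsNormalForm l l.prod where
  prod_eq := rfl
  letter g hg := (h.letter_mem g hg).1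
  alternating := h.isChain
  notMem_base _ g hg := (h.letter_mem g hg).2
  ne_one h1 := (h.letter_mem 1 (by simp [h1])).2 (one_mem _)

theorem IsAlternating.length_eq_of_isNormalForm (hm : IsAlternating (factor φ) (base φ) i m)
    (h : IsNormalForm l m.prod) : l.length = m.length := by
  have hF := isAmalgam_factor_base φ
  rcases h.isAlternating_or with ⟨k, hl⟩ | ⟨c, hc, hc1, rfl⟩
  · exact (hl.length_eq_and_coset_eq hF hm (one_mem _) (by simp [h.prod_eq])).1
  · have hprod : c = m.prod := by simpa using h.prod_eq
    obtain rfl := hF.eq_nil i m hm (hprod ▸ hc)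
    exact absurd hprod hc1

theorem IsNormalForm.length_eq_length (h : IsNormalForm l w) (h' : IsNormalForm m w) :
    l.length = m.length := by
  rcases h'.isAlternating_or with ⟨k, hm⟩ | ⟨c, -, -, rfl⟩
  · exact hm.length_eq_of_isNormalForm (by rwa [h'.prod_eq])
  rcases h.isAlternating_or with ⟨k, hl⟩ | ⟨d, -, -, rfl⟩
  · exact (hl.length_eq_of_isNormalForm (by rwa [h.prod_eq])).symm
  · rfl

theorem IsNormalForm.length_eq (h : IsNormalForm l w) : length w = l.length := by
  have : {n | ∃ l, IsNormalForm l w ∧ l.length = n} = {l.length} :=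
    Set.eq_singleton_iff_unique_mem.2 ⟨⟨l, h, rfl⟩, fun _ ⟨_, hm, hn⟩ =>
      hn ▸ hm.length_eq_length h⟩
  rw [length, this, csInf_singleton]

theorem IsWeaklyCyclicallyReduced.isCyclicallyReduced (h : IsWeaklyCyclicallyReduced w) :
    IsCyclicallyReduced (factor φ) (base φ) w := by
  rintro i g m g' hm rfl
  obtain ⟨l, hl, hlast⟩ := h
  have hlen : l.length = m.length + 2 := by
    simpa using hm.length_eq_of_isNormalForm hl
  obtain ⟨k, hl'⟩ := hl.exists_isAlternating (by omega)
  obtain ⟨u, l, u', rfl⟩ : ∃ u l₀ u', l = u :: l₀ ++ [u'] := by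
    obtain ⟨u, l, rfl⟩ := List.exists_cons_of_ne_nil (l := l) (by rintro rfl; simp at hlen)
    obtain ⟨l, u', rfl⟩ := List.eq_nil_or_concat' l |>.resolve_left (by rintro rfl; simp at hlen)
    exact ⟨u, l, u', rfl⟩
  intro hgg'
  exact hlast.resolve_left (by omega) u' (by rw [Option.mem_def, List.getLast?_concat]) u (by simp)
    (hm.last_mul_head_mem (isAmalgam_factor_base φ) hl' hl.prod_eq.symm hgg')

theorem IsSemireduced.exists_isAlternating (h : IsSemireduced b c)
    (hb : IsNormalForm (l ++ [g]) b) (hl : l ≠ []) :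
    ∃ k m, IsAlternating (factor φ) (base φ) k (l ++ m) ∧ (l ++ m).prod = b * c := by
  obtain ⟨k, hk⟩ := hb.exists_isAlternating (by simpa using hl)
  obtain ⟨m, hm, hprod⟩ := hk.exists_append_prod_eq (isAmalgam_factor_base φ) (w := c)
    fun k g' m hm hc => h _ _ hb (hc ▸ hm.isNormalForm) g (by simp) g' (by simp)
  exact ⟨k, m, hm, by rw [hprod, hb.prod_eq]⟩

theorem isSymmetrized_setOf_isConj (r : AmalgamatedProduct φ) :
    IsSymmetrized {w | IsWeaklyCyclicallyReduced w ∧ (IsConj r w ∨ IsConj r⁻¹ w)} := by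
  have conj_inv : ∀ {v w : AmalgamatedProduct φ}, IsConj v w → IsConj v⁻¹ w⁻¹ := fun h => by
    obtain ⟨c, rfl⟩ := isConj_iff.1 h
    exact isConj_iff.2 ⟨c, by group⟩
  rintro v ⟨hv, hrv⟩
  refine ⟨hv, fun w hw hvw => ⟨hw, ?_⟩⟩
  rcases hrv with hrv | hrv <;> rcases hvw with hvw | hvw
  · exact Or.inl (hrv.trans hvw)
  · exact Or.inr ((conj_inv hrv).trans hvw)
  · exact Or.inr (hrv.trans hvw)
  · exact Or.inl ((inv_inv r ▸ conj_inv hrv).trans hvw)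

theorem symmetrizedClosure_subset (hr : IsWeaklyCyclicallyReduced r) :
    symmetrizedClosure r ⊆ {w | IsWeaklyCyclicallyReduced w ∧ (IsConj r w ∨ IsConj r⁻¹ w)} :=
  fun _ hw => hw _ ⟨isSymmetrized_setOf_isConj r, hr, Or.inl (IsConj.refl r)⟩

theorem isSymmetrized_symmetrizedClosure (hr : IsWeaklyCyclicallyReduced r) :
    IsSymmetrized (symmetrizedClosure r) := fun w hw =>
  ⟨(symmetrizedClosure_subset hr hw).1, fun v hv h S hS => (hS.1 w (hw S hS)).2 v hv h⟩

end NormalForms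

section CyclicWordClosure

variable {K L : Type u} [Group K] [Group L] {H : Subgroup K} {H' : Subgroup L} {φ : H ≃* H'}
  {s : ℤ → AmalgamatedProduct φ} {n M : ℕ}

theorem IsCyclicWord.isWeaklyCyclicallyReduced (hs : IsCyclicWord (factor φ) (base φ) s n) :
    IsWeaklyCyclicallyReduced (seg s 0 n).prod := by
  have hF := isAmalgam_factor_base φ
  have hseg : ∀ (i : ℤ) (m : ℕ), IsAlternating (factor φ) (base φ) i.bodd (seg s i m) :=
    fun i m => by simpa using hs.isAlternating_seg_append (i := i) (m := m) (l := []) trivial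
  refine ⟨_, (hseg 0 n).isNormalForm, Or.inr ?_⟩
  obtain ⟨m, rfl⟩ := Nat.exists_eq_add_of_le' (hs.two_le hF)
  have hlast : s (0 + (m + 1 : ℕ)) = s (-1) := by
    rw [← hs.periodic (-1)]
    congr 1
    push_cast
    ring
  rw [seg_succ_right, List.getLast?_concat, ← seg_succ_right, seg_succ, hlast]
  simp only [List.head?_cons, Option.mem_def, Option.some.injEq]
  rintro _ rfl _ rfl h
  simpa [seg] using hF.eq_nil _ _ (hseg (-1) 2) (by simpa [seg, List.range_succ] using h)

theorem IsCyclicWord.exists_isShift_of_mem (hs : IsCyclicWord (factor φ) (base φ) s n)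
    {w : AmalgamatedProduct φ} (hw : w ∈ symmetrizedClosure (seg s 0 n).prod) :
    ∃ t, (t = s ∨ t = invSeq s) ∧ ∃ i b, IsShift (factor φ) (base φ) t n w i b := by
  have hF := isAmalgam_factor_base φ
  obtain ⟨hw, h | h⟩ := symmetrizedClosure_subset hs.isWeaklyCyclicallyReduced hw
  · exact ⟨s, Or.inl rfl, hs.exists_isShift hF hw.isCyclicallyReduced h⟩
  · refine ⟨invSeq s, Or.inr rfl, hs.inv.exists_isShift hF hw.isCyclicallyReduced
      (i := 1 - n) ?_⟩
    rwa [prod_seg_invSeq, sub_sub_cancel, sub_self]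

theorem IsCyclicWord.length_of_mem (hs : IsCyclicWord (factor φ) (base φ) s n)
    {w : AmalgamatedProduct φ} (hw : w ∈ symmetrizedClosure (seg s 0 n).prod) :
    length w = n ∨ length w = n + 1 := by
  have hF := isAmalgam_factor_base φ
  obtain ⟨t, ht, i, b, h⟩ := hs.exists_isShift_of_mem hw
  have ht : IsCyclicWord (factor φ) (base φ) t n := by
    rcases ht with rfl | rfl
    exacts [hs, hs.inv]
  obtain ⟨m, hm, rfl, hlen⟩ := h.exists_isAlternating hF ht
  rw [hm.isNormalForm.length_eq, List.length_cons, List.length_append, length_seg]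
  have := hs.two_le hF
  omega

theorem IsRigid.length_le_of_isPiece (hr : IsRigid (base φ) s n M)
    (hs : IsCyclicWord (factor φ) (base φ) s n)
    (hC : ∀ i : ℤ, ∃ j ∈ Set.Ico i (i + M), MeetsConjTrivially (base φ) (s j)) (hM : M + 1 < n)
    {b : AmalgamatedProduct φ} (hb : IsPiece (symmetrizedClosure (seg s 0 n).prod) b) :
    length b ≤ M + 1 := by
  by_contra! hlen
  obtain ⟨_, hr₁, _, hr₂, hne, c, c', rfl, rfl, hc, hc'⟩ := hb
  obtain ⟨_, l, hl, -⟩ := Nat.nonempty_of_pos_sInf (Nat.zero_lt_of_lt hlen)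
  rw [hl.length_eq] at hlen
  obtain ⟨l, g, rfl⟩ := (List.eq_nil_or_concat' l).resolve_left (by rintro rfl; simp at hlen)
  have hl' : M + 1 ≤ l.length := by simpa using hlen
  have hnil : l ≠ [] := by
    rintro rfl
    simp at hl'
  obtain ⟨k, m, hm, hmc⟩ := hc.exists_isAlternating hl hnil
  obtain ⟨k', m', hm', hmc'⟩ := hc'.exists_isAlternating hl hnil
  rw [← hmc] at hr₁ hne
  rw [← hmc'] at hr₂ hne
  obtain ⟨t, ht, i, b, h⟩ := hs.exists_isShift_of_mem hr₁
  obtain ⟨t', ht', i', b', h'⟩ := hs.exists_isShift_of_mem hr₂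
  exact hne (hr.prod_eq_of_isShift (isAmalgam_factor_base φ) hs hC hM hl' hm hm' ht ht' h h')

end CyclicWordClosure

section Interleave

variable {K L : Type u} [Group K] [Group L] {H : Subgroup K} {H' : Subgroup L} (φ : H ≃* H')

theorem ofLeft_injective : Function.Injective (ofLeft φ) :=
  Monoid.PushoutI.of_injective (incl_injective φ) false

theorem ofRight_injective : Function.Injective (ofRight φ) :=
  Monoid.PushoutI.of_injective (incl_injective φ) true

theorem base_eq_map_ofRight : base φ = H'.map (ofRight φ) := by
  rw [base_eq_range, ← Monoid.PushoutI.of_comp_eq_base (φ := incl φ) true, MonoidHom.range_comp]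
  congr 1
  change (H'.subtype.comp φ.toMonoidHom).range = H'
  rw [MonoidHom.range_comp, MonoidHom.range_eq_top.2 φ.surjective, ← MonoidHom.range_eq_map,
    H'.range_subtype]

theorem ofLeft_mem_base {g : K} : ofLeft φ g ∈ base φ ↔ g ∈ H :=
  Subgroup.mem_map_iff_mem (ofLeft_injective φ)

theorem ofRight_mem_base {g : L} : ofRight φ g ∈ base φ ↔ g ∈ H' := by
  rw [base_eq_map_ofRight]
  exact Subgroup.mem_map_iff_mem (ofRight_injective φ)

theorem ofLeft_mem_doubleCoset {g g' : K} :
    ofLeft φ g' ∈ DoubleCoset.doubleCoset (ofLeft φ g) (base φ) (base φ) ↔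
      g' ∈ DoubleCoset.doubleCoset g H H := by
  simp only [DoubleCoset.mem_doubleCoset, base, SetLike.mem_coe, Subgroup.mem_map]
  constructor
  · rintro ⟨_, ⟨c, hc, rfl⟩, _, ⟨d, hd, rfl⟩, h⟩
    exact ⟨c, hc, d, hd, ofLeft_injective φ (by simpa using h)⟩
  · rintro ⟨c, hc, d, hd, rfl⟩
    exact ⟨_, ⟨c, hc, rfl⟩, _, ⟨d, hd, rfl⟩, by simp⟩

theorem meetsConjTrivially_ofRight {a : L} (ha : MeetsConjTrivially H' a) :
    MeetsConjTrivially (base φ) (ofRight φ a) := by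
  rw [base_eq_map_ofRight]
  rintro _ ⟨c, hc, rfl⟩ h
  simp only [← map_inv, ← map_mul] at h
  rw [Subgroup.mem_map_iff_mem (ofRight_injective φ)] at h
  rw [ha c hc h, map_one]

/-- The sequence of letters `…, u 0, a, u 1, a, u 2, a, …` with `u 0` at position `0`. -/
def interleave (u : ℤ → K) (a : L) (q : ℤ) : AmalgamatedProduct φ :=
  if q.bodd then ofRight φ a else ofLeft φ (u (q / 2))

variable {u : ℤ → K} {a : L} {P W : ℕ}

theorem interleave_two_mul (q : ℤ) : interleave φ u a (2 * q) = ofLeft φ (u q) := by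
  rw [interleave, Int.bodd_mul, show (2 : ℤ).bodd = false from rfl]
  simp

theorem interleave_two_mul_add_one (q : ℤ) : interleave φ u a (2 * q + 1) = ofRight φ a := by
  rw [interleave, Int.bodd_add, Int.bodd_mul, show (2 : ℤ).bodd = false from rfl]
  simp

theorem prod_seg_interleave (p : ℤ) (n : ℕ) :
    (seg (interleave φ u a) (2 * p) (2 * n)).prod =
      ((seg u p n).map fun g => ofLeft φ g * ofRight φ a).prod := by
  induction n generalizing p with
  | zero => simp [seg]
  | succ n ih =>
    rw [mul_add, mul_one, seg_succ, seg_succ, add_assoc, one_add_one_eq_two, ← mul_add_one,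
      seg_succ, List.prod_cons, List.prod_cons, ih, interleave_two_mul, interleave_two_mul_add_one,
      List.map_cons, List.prod_cons, mul_assoc]

theorem isCyclicWord_interleave (hu : ∀ p, u p ∉ H) (hper : Function.Periodic u P) (hP : P ≠ 0)
    (ha : a ∉ H') : IsCyclicWord (factor φ) (base φ) (interleave φ u a) (2 * P : ℕ) where
  mem q := by
    unfold interleave
    cases q.bodd
    exacts [⟨_, rfl⟩, ⟨_, rfl⟩]
  notMem q := by
    unfold interleave
    cases q.bodd
    exacts [(ofLeft_mem_base φ).not.2 (hu _), (ofRight_mem_base φ).not.2 ha]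
  periodic q := by
    simp only [interleave, Int.bodd_add, Int.bodd_coe, Nat.bodd_mul, Nat.bodd_two, Bool.false_and,
      Bool.xor_false]
    rw [show (q + (2 * P : ℕ)) / 2 = q / 2 + P by grind, hper]
  ne_zero := by omega

theorem exists_meetsConjTrivially_interleave (ha : MeetsConjTrivially H' a) (i : ℤ) (hW : 1 ≤ W) :
    ∃ j ∈ Set.Ico i (i + (2 * W : ℕ)), MeetsConjTrivially (base φ) (interleave φ u a j) := by
  refine ⟨2 * (i / 2) + 1, by grind, ?_⟩
  rw [interleave_two_mul_add_one]
  exact meetsConjTrivially_ofRight φ ha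

theorem two_dvd_of_bodd_add_eq {i d : ℤ} (h : (i + d).bodd = i.bodd) : 2 ∣ d := by
  have hd : d.bodd = false := by
    rw [Int.bodd_add] at h
    revert h
    cases i.bodd <;> simp
  exact ⟨d.div2, by simpa [hd] using (Int.bodd_add_div2 d).symm⟩

theorem isRigid_interleave (hs : IsCyclicWord (factor φ) (base φ) (interleave φ u a) (2 * P : ℕ))
    (hr : IsRigid H u P W) : IsRigid (base φ) (interleave φ u a) (2 * P) (2 * W) where
  dvd i d h := by
    have hd : (i + d).bodd = i.bodd := (isAmalgam_factor_base φ).eq_of_mem_doubleCoset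
      (hs.mem i) (hs.mem _) (hs.notMem _) (h i (by grind [hr.pos]))
    obtain ⟨e, rfl⟩ : 2 ∣ d := two_dvd_of_bodd_add_eq hd
    push_cast
    refine mul_dvd_mul_left 2 (hr.dvd ((i + 1) / 2) e fun q hq => ?_)
    have := h (2 * q) (by grind)
    rwa [← mul_add, interleave_two_mul, interleave_two_mul, ofLeft_mem_doubleCoset] at this
  not_inv i d h := by
    have hd : (d - i).bodd = i.bodd := (isAmalgam_factor_base φ).eq_of_mem_doubleCoset
      (hs.mem i) (inv_mem (hs.mem _)) (inv_mem_iff.not.2 (hs.notMem _)) (h i (by grind [hr.pos]))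
    obtain ⟨e, rfl⟩ : 2 ∣ d :=
      two_dvd_of_bodd_add_eq (i := i)
        (by simpa [sub_eq_add_neg, Bool.xor_comm] using hd)
    refine hr.not_inv ((i + 1) / 2) e fun q hq => ?_
    have := h (2 * q) (by grind)
    rwa [← mul_sub, interleave_two_mul, interleave_two_mul, ← map_inv,
      ofLeft_mem_doubleCoset] at this

end Interleave

section Blocks

/-- The position at which block `k` starts in the sequence `h y x y² x y³ ⋯`, where block `k`
consists of `h` (for `k = 0`) or `x` and of `k + 1` copies of `y`. -/
def blockStart : ℕ → ℕ
  | 0 => 0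
  | k + 1 => blockStart k + (k + 2)

theorem blockStart_succ (k : ℕ) : blockStart (k + 1) = blockStart k + (k + 2) := rfl

theorem two_mul_blockStart (k : ℕ) : 2 * blockStart k = k * (k + 3) := by
  induction k with
  | zero => rfl
  | succ k ih => rw [blockStart_succ, mul_add, ih]; ring

theorem blockStart_strictMono : StrictMono blockStart :=
  strictMono_nat_of_lt_succ fun k => by rw [blockStart_succ]; omega

theorem exists_eq_blockStart_add {N r : ℕ} (hr : r < blockStart N) :
    ∃ k < N, ∃ t ≤ k + 1, r = blockStart k + t := by
  induction N with
  | zero => exact absurd hr (Nat.not_lt_zero r)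
  | succ N ih =>
    rcases lt_or_ge r (blockStart N) with h | h
    · obtain ⟨k, hk, ht⟩ := ih h
      exact ⟨k, by omega, ht⟩
    · rw [blockStart_succ] at hr
      exact ⟨N, N.lt_succ_self, r - blockStart N, by omega, by omega⟩

theorem exists_modEq_blockStart_add {N : ℕ} (hN : N ≠ 0) (p : ℤ) :
    ∃ k < N, ∃ t ≤ k + 1, p ≡ blockStart k + (t : ℕ) [ZMOD blockStart N] := by
  have hP : 0 < blockStart N := blockStart_strictMono (Nat.pos_of_ne_zero hN)
  obtain ⟨r, hr⟩ := Int.eq_ofNat_of_zero_le (Int.emod_nonneg p (b := blockStart N) (by omega))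
  have hlt := Int.emod_lt_of_pos p (b := blockStart N) (by omega)
  obtain ⟨k, hk, t, ht, rfl⟩ := exists_eq_blockStart_add (N := N) (r := r) (by omega)
  exact ⟨k, hk, t, ht, by rw [← Nat.cast_add, ← hr]; exact (Int.mod_modEq p _).symm⟩

variable {K : Type u}

open Classical in
/-- The letters `h y x y² x y³ ⋯ x y^N` of the relator that come from `K`, repeated periodically. -/
noncomputable def blockLetter (N : ℕ) (x y h : K) (p : ℤ) : K :=
  if p ≡ 0 [ZMOD blockStart N] then h
  else if ∃ k < N, p ≡ blockStart k [ZMOD blockStart N] then x else y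

variable {N : ℕ} {x y h : K}

theorem blockLetter_congr {p q : ℤ} (hpq : p ≡ q [ZMOD blockStart N]) :
    blockLetter N x y h p = blockLetter N x y h q := by
  have hz (z : ℤ) : p ≡ z [ZMOD blockStart N] ↔ q ≡ z [ZMOD blockStart N] :=
    ⟨hpq.symm.trans, hpq.trans⟩
  exact if_congr (hz 0) rfl (if_congr (by simp only [hz]) rfl rfl)

theorem periodic_blockLetter : Function.Periodic (blockLetter N x y h) (blockStart N) :=
  fun _ => blockLetter_congr (Int.add_modEq_left_iff.2 dvd_rfl)

theorem blockLetter_zero : blockLetter N x y h 0 = h := if_pos rfl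

theorem eq_of_natCast_modEq {m n P : ℕ} (h : (m : ℤ) ≡ n [ZMOD P]) (hm : m < P) (hn : n < P) :
    m = n :=
  (Int.natCast_modEq_iff.1 h).eq_of_lt_of_lt hm hn

theorem blockLetter_of_modEq_blockStart {k : ℕ} (hk : 0 < k) (hkN : k < N) {q : ℤ}
    (hq : q ≡ blockStart k [ZMOD blockStart N]) : blockLetter N x y h q = x := by
  rw [blockLetter, if_neg, if_pos ⟨k, hkN, hq⟩]
  intro h0
  have := eq_of_natCast_modEq (hq.symm.trans h0) (blockStart_strictMono hkN)
    (blockStart_strictMono (hk.trans hkN))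
  exact (blockStart_strictMono hk).ne' this

theorem blockLetter_add_of_modEq_blockStart {k t : ℕ} (hkN : k < N) (ht : 1 ≤ t)
    (htk : t ≤ k + 1) {q : ℤ} (hq : q ≡ blockStart k [ZMOD blockStart N]) :
    blockLetter N x y h (q + t) = y := by
  have hend : blockStart (k + 1) ≤ blockStart N := blockStart_strictMono.monotone hkN
  rw [blockStart_succ] at hend
  have not_head : ∀ j < N, ¬ q + t ≡ blockStart j [ZMOD blockStart N] := by
    intro j hj hqj
    have e : blockStart k + t = blockStart j :=
      eq_of_natCast_modEq (by exact_mod_cast (hq.symm.add_right t).trans hqj) (by omega)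
        (blockStart_strictMono hj)
    have h1 : k < j := blockStart_strictMono.lt_iff_lt.1 (by omega)
    have h2 : j < k + 1 := blockStart_strictMono.lt_iff_lt.1 (by rw [blockStart_succ]; omega)
    omega
  rw [blockLetter, if_neg (by simpa [blockStart] using not_head 0 (by omega)), if_neg]
  rintro ⟨j, hj, hqj⟩
  exact not_head j hj hqj

theorem add_modEq_blockStart_succ {k N : ℕ} {q : ℤ} (hq : q ≡ blockStart k [ZMOD blockStart N]) :
    q + (k + 2) ≡ blockStart (k + 1) [ZMOD blockStart N] := by
  simpa [blockStart_succ] using hq.add_right (k + 2 : ℤ)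

theorem seg_blockLetter_blockStart {k : ℕ} (hk : k < N) :
    seg (blockLetter N x y h) (blockStart k) (k + 2) =
      (if k = 0 then h else x) :: List.replicate (k + 1) y := by
  have hhead : blockLetter N x y h (blockStart k) = if k = 0 then h else x := by
    split_ifs with hk0
    · subst hk0
      exact blockLetter_zero
    · exact blockLetter_of_modEq_blockStart (Nat.pos_of_ne_zero hk0) hk rfl
  rw [seg_succ, hhead, List.eq_replicate_of_mem (a := y) (l := seg _ _ _), length_seg]
  simp only [seg, List.mem_map, List.mem_range]
  rintro _ ⟨t, ht, rfl⟩
  rw [add_assoc, ← Nat.cast_one, ← Nat.cast_add]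
  exact blockLetter_add_of_modEq_blockStart hk (by omega) (by omega) rfl

theorem blockLetter_cases (p : ℤ) :
    blockLetter N x y h p = h ∨ blockLetter N x y h p = x ∨ blockLetter N x y h p = y := by
  unfold blockLetter
  split_ifs <;> simp

theorem exists_blocks_mem_window (hN : 4 ≤ N) (p : ℤ) :
    ∃ k : ℕ, 0 < k ∧ k + 2 < N ∧ ∃ q : ℤ, q ≡ blockStart k [ZMOD blockStart N] ∧ p ≤ q ∧
      q + (2 * k + 5) < p + (3 * N + 10) := by
  obtain ⟨j, hj, t, ht, hp⟩ := exists_modEq_blockStart_add (N := N) (by omega) p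
  have hstart : p - t ≡ blockStart j [ZMOD blockStart N] := by simpa using hp.sub_right t
  by_cases hjN : j + 3 < N
  · refine ⟨j + 1, by omega, by omega, p - t + (j + 2), ?_, by omega, by push_cast; omega⟩
    simpa [blockStart_succ] using hstart.add_right (j + 2)
  · have hlast : blockStart N ≤ blockStart j + 3 * N := by
      obtain ⟨M, rfl⟩ := Nat.exists_eq_add_of_le' (show 3 ≤ N by omega)
      have := blockStart_strictMono.monotone (show M ≤ j by omega)
      simp only [blockStart_succ]
      omega
    have hend : blockStart (j + 1) ≤ blockStart N := blockStart_strictMono.monotone hj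
    rw [blockStart_succ] at hend
    refine ⟨1, one_pos, by omega, p - t - blockStart j + (blockStart 1 + blockStart N), ?_, ?_, ?_⟩
    · simpa using (hstart.sub_right (blockStart j)).add_right (blockStart 1 + blockStart N : ℤ)
    · omega
    · simp only [blockStart]
      omega

section Pattern

variable {X Y : Set K} (hx : x ∈ X) (hy : y ∈ Y) (hXY : Disjoint X Y)

include hx hy hXY

theorem modEq_blockStart_of_pattern {k : ℕ} (hkN : k < N) {q : ℤ}
    (hq : blockLetter N x y h q ∈ X) (hq' : blockLetter N x y h (q + (k + 2)) ∈ X)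
    (hqt : ∀ t : ℕ, 1 ≤ t → t ≤ k + 1 → blockLetter N x y h (q + t) ∈ Y) :
    q ≡ blockStart k [ZMOD blockStart N] := by
  have hyX : y ∉ X := fun hyX => hXY.notMem_of_mem_left hyX hy
  have hxY : x ∉ Y := hXY.notMem_of_mem_left hx
  obtain ⟨j, hj, t, ht, hqj⟩ := exists_modEq_blockStart_add (N := N) (by omega) q
  obtain rfl : t = 0 := by
    by_contra ht0
    rw [blockLetter_congr hqj, blockLetter_add_of_modEq_blockStart hj (by omega) ht rfl] at hq
    exact hyX hq
  rw [Nat.cast_zero, add_zero] at hqj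
  rcases lt_trichotomy k j with hkj | rfl | hjk
  · have := blockLetter_add_of_modEq_blockStart (x := x) (y := y) (h := h) hj
      (t := k + 2) (by omega) (by omega) hqj
    rw [Nat.cast_add, Nat.cast_two] at this
    exact absurd (this ▸ hq') hyX
  · exact hqj
  · have hnext : q + (j + 2 : ℕ) ≡ blockStart (j + 1) [ZMOD blockStart N] := by
      rw [blockStart_succ, Nat.cast_add]
      exact hqj.add_right _
    have := hqt (j + 2) (by omega) (by omega)
    rw [blockLetter_of_modEq_blockStart (by omega) (by omega) hnext] at this
    exact absurd this hxY

theorem blockStart_dvd_of_window (hN : 4 ≤ N) {p d : ℤ}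
    (hX : ∀ q ∈ Set.Ico p (p + (3 * N + 10 : ℕ)),
      blockLetter N x y h q ∈ X → blockLetter N x y h (q + d) ∈ X)
    (hY : ∀ q ∈ Set.Ico p (p + (3 * N + 10 : ℕ)),
      blockLetter N x y h q ∈ Y → blockLetter N x y h (q + d) ∈ Y) :
    (blockStart N : ℤ) ∣ d := by
  obtain ⟨k, hk, hkN, q, hq, hpq, hqp⟩ := exists_blocks_mem_window hN p
  have hq₁ := add_modEq_blockStart_succ hq
  suffices q + d ≡ blockStart k [ZMOD blockStart N] from
    Int.add_modEq_left_iff.1 (this.trans hq.symm)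
  apply modEq_blockStart_of_pattern hx hy hXY (h := h) (by omega)
  · exact hX q (by grind) (by rwa [blockLetter_of_modEq_blockStart hk (by omega) hq])
  · rw [add_right_comm]
    exact hX _ (by grind) (by rwa [blockLetter_of_modEq_blockStart k.succ_pos (by omega) hq₁])
  · intro t ht htk
    rw [add_right_comm]
    exact hY _ (by grind) (by rwa [blockLetter_add_of_modEq_blockStart (by omega) ht htk hq])

theorem modEq_blockStart_of_reversed_pattern {k : ℕ} (hk : 0 < k) (hkN : k + 1 < N) {q d : ℤ}
    (hq : q ≡ blockStart k [ZMOD blockStart N])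
    (hX : ∀ j ∈ Set.Icc q (q + (k + 2)),
      blockLetter N x y h j ∈ X → blockLetter N x y h (d - j) ∈ X)
    (hY : ∀ j ∈ Set.Icc q (q + (k + 2)),
      blockLetter N x y h j ∈ Y → blockLetter N x y h (d - j) ∈ Y) :
    d - q ≡ blockStart (k + 1) [ZMOD blockStart N] := by
  have hq₁ := add_modEq_blockStart_succ hq
  suffices d - (q + (k + 2)) ≡ blockStart k [ZMOD blockStart N] by
    simpa [← sub_sub, blockStart_succ] using this.add_right (k + 2 : ℤ)
  apply modEq_blockStart_of_pattern hx hy hXY (h := h) (by omega)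
  · exact hX _ (by grind) (by rwa [blockLetter_of_modEq_blockStart k.succ_pos hkN hq₁])
  · rw [← sub_sub, sub_add_cancel]
    exact hX q (by grind) (by rwa [blockLetter_of_modEq_blockStart hk (by omega) hq])
  · intro t ht htk
    have := hY (q + (k + 2 - t : ℕ)) (by grind)
      (by rwa [blockLetter_add_of_modEq_blockStart (by omega) (by omega) (by omega) hq])
    convert this using 2
    omega

theorem not_reversed_window (hN : 4 ≤ N) (p d : ℤ) :
    ¬ ((∀ q ∈ Set.Ico p (p + (3 * N + 10 : ℕ)),
      blockLetter N x y h q ∈ X → blockLetter N x y h (d - q) ∈ X) ∧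
    ∀ q ∈ Set.Ico p (p + (3 * N + 10 : ℕ)),
      blockLetter N x y h q ∈ Y → blockLetter N x y h (d - q) ∈ Y) := by
  rintro ⟨hX, hY⟩
  obtain ⟨k, hk, hkN, q, hq, hpq, hqp⟩ := exists_blocks_mem_window hN p
  have hq₁ := add_modEq_blockStart_succ hq
  have h₁ := modEq_blockStart_of_reversed_pattern hx hy hXY (h := h) (d := d) hk (by omega) hq
    (fun j hj => hX j (by grind)) fun j hj => hY j (by grind)
  have h₂ := modEq_blockStart_of_reversed_pattern hx hy hXY (h := h) (d := d) k.succ_pos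
    (by omega) hq₁ (fun j hj => hX j (by grind)) fun j hj => hY j (by grind)
  -- Read backwards, a block would have to be followed by a shorter one.
  have hshift : (blockStart (k + 1) : ℤ) + (2 * k + 5 : ℕ) ≡ blockStart (k + 1)
      [ZMOD blockStart N] := by
    convert (h₂.symm.add_right (k + 2)).trans (by simpa [← sub_sub] using h₁) using 1
    rw [blockStart_succ (k + 1)]
    push_cast
    ring
  have hdvd := Int.natCast_dvd_natCast.1 (Int.add_modEq_left_iff.1 hshift)
  have hle := Nat.le_of_dvd (by omega) hdvd
  have := two_mul_blockStart N
  nlinarith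

end Pattern

variable [Group K] {H : Subgroup K}

/-- The union `H z H ∪ H z⁻¹ H`, the class of letters that good fellows of `z` avoid. -/
def signedDoubleCoset (H : Subgroup K) (z : K) : Set K :=
  DoubleCoset.doubleCoset z H H ∪ DoubleCoset.doubleCoset z⁻¹ H H

theorem mem_signedDoubleCoset_self (H : Subgroup K) (z : K) : z ∈ signedDoubleCoset H z :=
  Or.inl (DoubleCoset.mem_doubleCoset_self H H z)

theorem mem_signedDoubleCoset_of_mem_doubleCoset {g g' z : K}
    (hg : g ∈ signedDoubleCoset H z) (h : g' ∈ DoubleCoset.doubleCoset g H H) :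
    g' ∈ signedDoubleCoset H z := by
  rcases hg with hz | hz <;> rw [DoubleCoset.doubleCoset_eq_of_mem hz] at h
  exacts [Or.inl h, Or.inr h]

theorem inv_mem_signedDoubleCoset {g z : K} (hg : g⁻¹ ∈ signedDoubleCoset H z) :
    g ∈ signedDoubleCoset H z := by
  simpa [signedDoubleCoset, inv_mem_doubleCoset_iff, or_comm] using hg

theorem disjoint_signedDoubleCoset (hxy : GoodFellows H x y) :
    Disjoint (signedDoubleCoset H x) (signedDoubleCoset H y) := by
  have h := hxy.2.2
  simp only [signedDoubleCoset, Set.disjoint_union_left, Set.disjoint_union_right]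
  exact ⟨⟨by simpa using h 1 1, by simpa using h (-1) 1⟩,
    by simpa using h 1 (-1), by simpa using h (-1) (-1)⟩

theorem isRigid_blockLetter (hxy : GoodFellows H x y) (hN : 4 ≤ N) :
    IsRigid H (blockLetter N x y h) (blockStart N) (3 * N + 10) where
  dvd p d hd := by
    have hZ (z : K) q (hq : q ∈ Set.Ico p (p + (3 * N + 10 : ℕ)))
        (hz : blockLetter N x y h q ∈ signedDoubleCoset H z) :=
      mem_signedDoubleCoset_of_mem_doubleCoset hz (hd q hq)
    exact blockStart_dvd_of_window (mem_signedDoubleCoset_self H x) (mem_signedDoubleCoset_self H y)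
      (disjoint_signedDoubleCoset hxy) hN (hZ x) (hZ y)
  not_inv p d hd := by
    have hZ (z : K) q (hq : q ∈ Set.Ico p (p + (3 * N + 10 : ℕ)))
        (hz : blockLetter N x y h q ∈ signedDoubleCoset H z) :=
      inv_mem_signedDoubleCoset (mem_signedDoubleCoset_of_mem_doubleCoset hz (hd q hq))
    exact not_reversed_window (mem_signedDoubleCoset_self H x) (mem_signedDoubleCoset_self H y)
      (disjoint_signedDoubleCoset hxy) hN p d ⟨hZ x, hZ y⟩

end Blocks

section Relator

variable {K L : Type u} [Group K] [Group L] {H : Subgroup K} {H' : Subgroup L} (φ : H ≃* H')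
  (x y h : K) (a : L)

/-- The word `h a (y a) · x a (y a)² ⋯ x a (y a)^N`: the relator of the lemma with `N` blocks in
place of 80. -/
def blockRelator (N : ℕ) : AmalgamatedProduct φ :=
  ((List.range N).map fun k =>
    ofLeft φ (if k = 0 then h else x) * ofRight φ a * (ofLeft φ y * ofRight φ a) ^ (k + 1)).prod

theorem relator_eq_blockRelator : relator φ x y h a = blockRelator φ x y h a 80 := by
  rw [blockRelator, List.range_succ_eq_map]
  simp [relator, Function.comp_def]

theorem prod_map_seg_blockLetter {N n : ℕ} (hn : n ≤ N) :
    ((seg (blockLetter N x y h) 0 (blockStart n)).map fun g => ofLeft φ g * ofRight φ a).prod =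
      blockRelator φ x y h a n := by
  induction n with
  | zero => simp [seg, blockStart, blockRelator]
  | succ n ih =>
    rw [blockStart_succ, seg_add, List.map_append, List.prod_append, ih (by omega), zero_add,
      seg_blockLetter_blockStart hn, blockRelator, blockRelator, List.range_succ,
      List.map_append, List.prod_append, List.map_cons, List.map_replicate, List.prod_cons,
      List.prod_replicate, List.map_singleton, List.prod_singleton]

theorem blockRelator_eq_prod_seg (N : ℕ) :
    blockRelator φ x y h a N =
      (seg (interleave φ (blockLetter N x y h) a) 0 (2 * blockStart N)).prod := by
  rw [← prod_map_seg_blockLetter φ x y h a le_rfl, ← prod_seg_interleave, mul_zero]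

variable {x y h a} {N : ℕ}

theorem isCyclicWord_blockRelator (hxy : GoodFellows H x y) (ha : a ∉ H') (hh : h ∉ H)
    (hN : N ≠ 0) : IsCyclicWord (factor φ) (base φ)
      (interleave φ (blockLetter N x y h) a) (2 * blockStart N : ℕ) :=
  isCyclicWord_interleave φ
    (fun p => by
      rcases blockLetter_cases (N := N) (x := x) (y := y) (h := h) p with e | e | e <;> rw [e]
      exacts [hh, hxy.1, hxy.2.1])
    periodic_blockLetter (blockStart_strictMono (Nat.pos_of_ne_zero hN)).ne' ha

theorem isSymmetrized_symmetrizedClosure_blockRelator (hxy : GoodFellows H x y) (ha : a ∉ H')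
    (hh : h ∉ H) (hN : N ≠ 0) : IsSymmetrized (symmetrizedClosure (blockRelator φ x y h a N)) := by
  rw [blockRelator_eq_prod_seg]
  exact isSymmetrized_symmetrizedClosure
    (isCyclicWord_blockRelator φ hxy ha hh hN).isWeaklyCyclicallyReduced

theorem length_of_mem_symmetrizedClosure_blockRelator (hxy : GoodFellows H x y) (ha : a ∉ H')
    (hh : h ∉ H) (hN : N ≠ 0) {r : AmalgamatedProduct φ}
    (hr : r ∈ symmetrizedClosure (blockRelator φ x y h a N)) :
    length r = N * (N + 3) ∨ length r = N * (N + 3) + 1 := by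
  rw [blockRelator_eq_prod_seg] at hr
  rw [← two_mul_blockStart]
  exact (isCyclicWord_blockRelator φ hxy ha hh hN).length_of_mem hr

theorem length_le_of_isPiece_blockRelator (hxy : GoodFellows H x y) (ha : a ∉ H')
    (haH : ∀ g ∈ H', a⁻¹ * g * a ∈ H' → a⁻¹ * g * a = 1) (hh : h ∉ H) (hN : 7 ≤ N)
    {b : AmalgamatedProduct φ}
    (hb : IsPiece (symmetrizedClosure (blockRelator φ x y h a N)) b) :
    length b ≤ 6 * N + 21 := by
  have hconj : MeetsConjTrivially H' a := fun g hg hga => by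
    simpa [mul_assoc, inv_mul_eq_one, eq_comm] using haH g hg hga
  rw [blockRelator_eq_prod_seg] at hb
  have hs := isCyclicWord_blockRelator φ hxy ha hh (N := N) (by omega)
  have hr := isRigid_interleave φ hs (isRigid_blockLetter (h := h) hxy (by omega))
  have := hr.length_le_of_isPiece hs
    (fun i => exists_meetsConjTrivially_interleave φ hconj i (by omega))
    (by rw [two_mul_blockStart]; nlinarith) hb
  omega

end Relator

end Amalgam

theorem lemmaA2_general {K L : Type u} [Group K] [Group L] (H : Subgroup K) (H' : Subgroup L)
    (φ : H ≃* H') (x y h : K) (a : L) (hxy : GoodFellows H x y) (ha : a ∉ H')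
    (haH : ∀ g ∈ H', a⁻¹ * g * a ∈ H' → a⁻¹ * g * a = 1) (hh : h ∉ H) {N : ℕ} (hN : 7 ≤ N)
    {lam : ℝ} (hlam : 6 * N + 21 < lam * (N * (N + 3))) :
    Amalgam.SmallCancellation lam
        (Amalgam.symmetrizedClosure (Amalgam.blockRelator φ x y h a N)) ∧
      (∀ b, Amalgam.IsPiece (Amalgam.symmetrizedClosure (Amalgam.blockRelator φ x y h a N)) b →
        Amalgam.length b ≤ 6 * N + 21) ∧
      ∀ r ∈ Amalgam.symmetrizedClosure (Amalgam.blockRelator φ x y h a N),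
        Amalgam.length r = N * (N + 3) ∨ Amalgam.length r = N * (N + 3) + 1 := by
  have hpos : 0 < (N : ℝ) * (N + 3) := by positivity
  have hlam_pos : 0 < lam := pos_of_mul_pos_left (by linarith) hpos.le
  have hpiece b := Amalgam.length_le_of_isPiece_blockRelator φ hxy ha haH hh hN (b := b)
  have hlength r := Amalgam.length_of_mem_symmetrizedClosure_blockRelator φ hxy ha hh (r := r)
    (show N ≠ 0 by omega)
  have hlong : ∀ r ∈ Amalgam.symmetrizedClosure (Amalgam.blockRelator φ x y h a N),
      6 * N + 21 < lam * Amalgam.length r := fun r hr => by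
    have : N * (N + 3) ≤ Amalgam.length r := by rcases hlength r hr with e | e <;> omega
    exact hlam.trans_le (mul_le_mul_of_nonneg_left (by exact_mod_cast this) hlam_pos.le)
  refine ⟨⟨?_, fun r hr b c hb _ _ => ?_, fun r hr => ?_⟩, hpiece, hlength⟩
  · exact Amalgam.isSymmetrized_symmetrizedClosure_blockRelator φ hxy ha hh (by omega)
  · exact lt_of_le_of_lt (by exact_mod_cast hpiece b hb) (hlong r hr)
  · rw [div_lt_iff₀' hlam_pos]
    linarith [hlong r hr]

theorem lemmaA2 {K L : Type u} [Group K] [Group L] (H : Subgroup K) (H' : Subgroup L)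
    (φ : H ≃* H') (x y h : K) (a : L) (hxy : GoodFellows H x y) (ha : a ∉ H')
    (haH : ∀ g ∈ H', a⁻¹ * g * a ∈ H' → a⁻¹ * g * a = 1) (hh : h ∉ H) :
    Amalgam.SmallCancellation (1 / 10)
        (Amalgam.symmetrizedClosure (Amalgam.relator φ x y h a)) ∧
      (∀ b, Amalgam.IsPiece (Amalgam.symmetrizedClosure (Amalgam.relator φ x y h a)) b →
        Amalgam.length b ≤ 601) ∧
      ∀ r ∈ Amalgam.symmetrizedClosure (Amalgam.relator φ x y h a),
        Amalgam.length r = 6640 ∨ Amalgam.length r = 6641 := by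
  rw [Amalgam.relator_eq_blockRelator]
  obtain ⟨hR, hpiece, hlength⟩ := lemmaA2_general H H' φ x y h a hxy ha haH hh (N := 80)
    (lam := 1 / 10) (by norm_num) (by norm_num)
  exact ⟨hR, fun b hb => (hpiece b hb).trans (by norm_num), hlength⟩
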